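/- For a sequence $(c_k)_{k\ge 0}$ let $H_n(c_k)=\det_{0\le i,j\le n}(c_{i+j})$ be its $n$th Hankel determinant. For integers $s\ge 1$ and $k\ge 0$ let $$T_k(s) = 1-2^k+3^k-\cdots+(-1)^{s-1}s^k.$$ (a) Let $s=2t$ be even ($t\ge 1$). Then for all integers $m\ge 0$ we have $H_{2m}(T_k(2t))=0$ and $$H_{2m+1}(T_k(2t))=\left(-t^2\right)^{m+1}\prod_{\ell=1}^m\big(\ell^2(t^2-\ell^2)\big)^{2(m+1-\ell)};$$ in particular, $H_{2m+1}(T_k(2t))=0$ for $m\ge t$. (b) Let $s\ge 1$ be odd. Then for all integers $m\ge 0$ we have $$H_{2m}(T_k(s))=\frac{(-1)^m}{m!^2}\prod_{\ell=1}^m\left(\frac{\ell^2}{4}\big(s^2-(2\ell-1)^2\big)\right)^{2(m+1-\ell)},$$ $$H_{2m+1}(T_k(s))=\frac{1}{4^{m+1}}\prod_{\ell=0}^m\frac{\ell!^4}{16^\ell}\big(s^2-(2\ell+1)^2\big)^{2(m-\ell)+1}.$$ In particular, $H_{2m}(T_k(s))=0$ for $m\ge (s+1)/2$, and $H_{2m+1}(T_k(s))=0$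 for $m\ge (s-1)/2$. -/

import Mathlib

/-- The `n`-th Hankel determinant `H_n(c) = det (c_{i+j})_{0 ≤ i, j ≤ n}` of a sequence `c`
(a determinant of order `n + 1`). -/
def hankelDet {R : Type*} [CommRing R] (n : ℕ) (c : ℕ → R) : R :=
  Matrix.det (Matrix.of fun i j : Fin (n + 1) => c ((i : ℕ) + (j : ℕ)))

/-- The alternating power sum `T_k(s) = 1 - 2^k + 3^k - ⋯ + (-1)^(s-1) s^k`, as a rational
number. -/
def altPowerSum (s k : ℕ) : ℚ :=
  ∑ j ∈ Finset.Icc 1 s, (-1 : ℚ) ^ (j - 1) * (j : ℚ) ^ k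

open Polynomial Finset

/-! The numbers `altPowerSum s k` are the moments of the functional L(f) = f(1) - f(2) + ⋯ ± f(s),
and a Hankel determinant is a Gram determinant in any graded monic bases. The reflection j ↦ s + 1 -
j shows that L kills polynomials even about (s + 1)/2 when s is even, and odd ones when s is odd. So
with z the centred variable and w a quadratic in z², everything reduces to one functional M in w:
M(f) = L(z f(w)) for s even, M(f) = L(f(w)) for s odd.

Telescoping gives M(`fallingBasis e k`) = c ∏ v_i, which makes the dual Hahn polynomials orthogonal
for M, and their kernel polynomials orthogonal for f ↦ M(X f), with explicit norms
(`map_pow_mul_dualHahn`). With monomial rows and orthogonal columns, the Gram matrix is triangular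
for s odd. For s even only the pairings of opposite parity survive; the order 2m + 2 matrix is a
triangular one tensored with the 2 × 2 swap, while at order 2m + 1 the last column vanishes. -/

/-- A Hankel determinant may be computed as the determinant of the pairings of any two graded
families of monic polynomials. -/
theorem hankelDet_eq_det_gram {R : Type*} [CommRing R] (L : R[X] →ₗ[R] R) (p q : ℕ → R[X])
    (hp : ∀ i, (p i).Monic) (hpd : ∀ i, (p i).natDegree = i)
    (hq : ∀ i, (q i).Monic) (hqd : ∀ i, (q i).natDegree = i) (n : ℕ) :
    hankelDet n (fun k => L (X ^ k)) =
      Matrix.det (Matrix.of fun i j : Fin (n + 1) => L (p i * q j)) := by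
  have expand : ∀ (r : ℕ → R[X]), (∀ i, (r i).natDegree = i) → ∀ i : Fin (n + 1),
      r i = ∑ k : Fin (n + 1), (r i).coeff k • (X : R[X]) ^ (k : ℕ) := by
    intro r hr i
    conv_lhs => rw [(r i).as_sum_range' (n + 1) (by rw [hr]; exact i.2)]
    rw [Fin.sum_univ_eq_sum_range (fun k => (r i).coeff k • (X : R[X]) ^ k)]
    simp only [smul_X_eq_monomial]
  have tri : ∀ (r : ℕ → R[X]), (∀ i, (r i).Monic) → (∀ i, (r i).natDegree = i) →
      Matrix.det (Matrix.of fun i k : Fin (n + 1) => (r i).coeff k) = 1 := by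
    intro r hm hr
    rw [Matrix.det_of_isLowerTriangular]
    · refine prod_eq_one fun i _ => ?_
      have := hm i
      rw [Monic, leadingCoeff, hr] at this
      exact this
    · intro i k hik
      have hik : i < k := hik
      exact coeff_eq_zero_of_natDegree_lt (by rw [hr]; exact hik)
  have key : (Matrix.of fun i j : Fin (n + 1) => L (p i * q j)) =
      (Matrix.of fun i k : Fin (n + 1) => (p i).coeff k) *
        (Matrix.of fun i j : Fin (n + 1) => L (X ^ ((i : ℕ) + (j : ℕ)))) *
        (Matrix.of fun i k : Fin (n + 1) => (q i).coeff k).transpose := by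
    ext i j
    simp only [Matrix.of_apply, Matrix.mul_apply, Matrix.transpose_apply]
    conv_lhs => rw [expand p hpd i, expand q hqd j]
    rw [sum_mul_sum, sum_comm, map_sum]
    refine sum_congr rfl fun _ _ => ?_
    rw [map_sum, sum_mul]
    refine sum_congr rfl fun _ _ => ?_
    rw [smul_mul_smul_comm, map_smul, ← pow_add, smul_eq_mul]
    ring
  rw [key, Matrix.det_mul, Matrix.det_mul, Matrix.det_transpose, tri p hp hpd, tri q hq hqd,
    one_mul, mul_one]
  rfl

/-! ### Dual Hahn polynomials and their kernel polynomials -/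

/-- The falling basis `∏_{i < k} (Y - i (i + e))`. -/
noncomputable def fallingBasis (e : ℚ) (k : ℕ) : ℚ[X] :=
  ∏ i ∈ range k, (X - C ((i : ℚ) * (i + e)))

/-- The shifted falling basis `∏_{1 ≤ i ≤ k} (Y - i (i + e))`. -/
noncomputable def shiftedBasis (e : ℚ) (k : ℕ) : ℚ[X] :=
  ∏ i ∈ range k, (X - C (((i : ℚ) + 1) * (i + 1 + e)))

/-- The quantities `v_{i+1} = K - (i + 1) (i + e)`. -/
def hahnWeight (K e : ℚ) (i : ℕ) : ℚ := K - ((i : ℚ) + 1) * (i + e)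

/-- Monic dual Hahn polynomials. -/
noncomputable def dualHahn (K e : ℚ) (n : ℕ) : ℚ[X] :=
  ∑ k ∈ range (n + 1),
    C ((-1) ^ (n + k) * (n.choose k : ℚ) * ∏ i ∈ Ico k n, hahnWeight K e i) * fallingBasis e k

/-- The kernel polynomials of the monic dual Hahn polynomials. -/
noncomputable def dualHahnKernel (K e : ℚ) (n : ℕ) : ℚ[X] :=
  ∑ k ∈ range (n + 1),
    C ((-1) ^ (n + k) * (n.choose k : ℚ) * ∏ i ∈ Ico (k + 1) (n + 1), hahnWeight K e i) *
      shiftedBasis e k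

theorem X_mul_shiftedBasis (e : ℚ) (k : ℕ) :
    X * shiftedBasis e k = fallingBasis e (k + 1) := by
  simp [shiftedBasis, fallingBasis, prod_range_succ', mul_comm]

theorem fallingBasis_succ_eq (e : ℚ) (k : ℕ) :
    fallingBasis e (k + 1) =
      shiftedBasis e (k + 1) + C (((k : ℚ) + 1) * (k + 1 + e)) * shiftedBasis e k := by
  rw [← X_mul_shiftedBasis, shiftedBasis, shiftedBasis, prod_range_succ]
  ring

theorem X_mul_dualHahnKernel (K e : ℚ) (n : ℕ) :
    X * dualHahnKernel K e n = dualHahn K e (n + 1) + C (hahnWeight K e n) * dualHahn K e n := by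
  have h2 : dualHahn K e n = ∑ k ∈ range (n + 2),
      C ((-1) ^ (n + k) * (n.choose k : ℚ) * ∏ i ∈ Ico k n, hahnWeight K e i) *
        fallingBasis e k := by
    rw [sum_range_succ, Nat.choose_succ_self]
    simp [dualHahn]
  rw [h2, dualHahn, dualHahnKernel, sum_range_succ' _ (n + 1), sum_range_succ' _ (n + 1),
    mul_add, mul_sum, mul_sum]
  have h0 : C ((-1) ^ (n + 1 + 0) * ((n + 1).choose 0 : ℚ) *
        ∏ i ∈ Ico 0 (n + 1), hahnWeight K e i) * fallingBasis e 0 +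
      C (hahnWeight K e n) * (C ((-1) ^ (n + 0) * (n.choose 0 : ℚ) *
        ∏ i ∈ Ico 0 n, hahnWeight K e i) * fallingBasis e 0) = 0 := by
    rw [prod_Ico_succ_top (Nat.zero_le n), ← mul_assoc (C _), ← C_mul, ← add_mul, ← C_add]
    convert zero_mul _
    convert C_0
    simp only [Nat.choose_zero_right]
    ring
  rw [add_add_add_comm, h0, add_zero, ← sum_add_distrib]
  refine sum_congr rfl fun k hk => ?_
  rw [mul_left_comm, X_mul_shiftedBasis, ← mul_assoc, ← C_mul, ← add_mul, ← C_add]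
  congr 2
  rw [Nat.choose_succ_succ]
  rcases Nat.lt_or_ge k n with h | h
  · rw [prod_Ico_succ_top (by omega)]
    push_cast
    ring
  · obtain rfl : k = n := by have := mem_range.1 hk; omega
    simp [Nat.choose_succ_self]

theorem dualHahn_succ_eq (K e : ℚ) (n : ℕ) :
    dualHahn K e (n + 1) =
      dualHahnKernel K e (n + 1) - C (((n : ℚ) + 1) ^ 2) * dualHahnKernel K e n := by
  have hR : dualHahnKernel K e n = ∑ k ∈ range (n + 2),
      C ((-1) ^ (n + k) * (n.choose k : ℚ) * ∏ i ∈ Ico (k + 1) (n + 1), hahnWeight K e i) *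
        shiftedBasis e k := by
    rw [sum_range_succ, Nat.choose_succ_self]
    simp [dualHahnKernel]
  -- `fallingBasis_succ_eq` rewrites the sum in the shifted basis; each coefficient collects the
  -- terms k and k + 1.
  have hP : dualHahn K e (n + 1) = ∑ k ∈ range (n + 2),
      (C ((-1) ^ (n + 1 + k) * ((n + 1).choose k : ℚ) *
          ∏ i ∈ Ico k (n + 1), hahnWeight K e i) +
        C ((-1) ^ (n + 1 + (k + 1)) * ((n + 1).choose (k + 1) : ℚ) *
          (∏ i ∈ Ico (k + 1) (n + 1), hahnWeight K e i) * (((k : ℚ) + 1) * (k + 1 + e)))) *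
        shiftedBasis e k := by
    simp only [add_mul (C _)]
    rw [sum_add_distrib, sum_range_succ' _ (n + 1), sum_range_succ _ (n + 1),
      Nat.choose_succ_self, dualHahn, sum_range_succ' _ (n + 1)]
    simp only [fallingBasis_succ_eq, mul_add (C _), sum_add_distrib, ← mul_assoc (C _), ← C_mul]
    rw [show fallingBasis e 0 = shiftedBasis e 0 by simp [fallingBasis, shiftedBasis]]
    simp only [Nat.cast_zero, mul_zero, zero_mul, C_0, add_zero]
    rw [add_right_comm]
  rw [hP, hR, dualHahnKernel, mul_sum, ← sum_sub_distrib]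
  refine sum_congr rfl fun k hk => ?_
  rw [← mul_assoc (C _), ← C_mul, ← sub_mul, ← C_add, ← C_sub]
  congr 2
  have hk : k ≤ n + 1 := by have := mem_range.1 hk; omega
  have e1 : ((n + 1).choose (k + 1) : ℚ) * (k + 1) = ((n + 1).choose k : ℚ) * (n + 1 - k) := by
    have := Nat.choose_succ_right_eq (n + 1) k
    have := congrArg (Nat.cast (R := ℚ)) this
    push_cast [Nat.cast_sub hk] at this
    exact this
  have e2 : (n.choose k : ℚ) * (n + 1) = ((n + 1).choose k : ℚ) * (n + 1 - k) := by
    have := Nat.choose_mul_succ_eq n k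
    have := congrArg (Nat.cast (R := ℚ)) this
    push_cast [Nat.cast_sub hk] at this
    exact this
  rcases Nat.lt_or_ge k (n + 1) with h | h
  · rw [prod_eq_prod_Ico_succ_bot h, prod_Ico_succ_top (by omega : k + 1 ≤ n + 1)]
    generalize ∏ i ∈ Ico (k + 1) (n + 1), hahnWeight K e i = V
    -- The difference of two weights factors, and n + 1 - k is the factor that `e1` and `e2` absorb
    -- into binomials.
    have hv : hahnWeight K e k =
        hahnWeight K e (n + 1) + ((n : ℚ) + 1 - k) * (n + k + 2 + e) := by
      simp only [hahnWeight]; push_cast; ring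
    rw [hv]
    linear_combination (-1) ^ (n + k) * V * (((k : ℚ) + 1 + e) * e1 + (n + 1) * e2)
  · obtain rfl : k = n + 1 := by omega
    simp [Nat.choose_succ_self]

theorem dualHahn_zero (K e : ℚ) : dualHahn K e 0 = 1 := by simp [dualHahn, fallingBasis]

theorem dualHahnKernel_zero (K e : ℚ) : dualHahnKernel K e 0 = 1 := by
  simp [dualHahnKernel, shiftedBasis]

theorem dualHahn_monic_and_kernel (K e : ℚ) (n : ℕ) :
    ((dualHahn K e n).Monic ∧ (dualHahn K e n).natDegree = n) ∧
      ((dualHahnKernel K e n).Monic ∧ (dualHahnKernel K e n).natDegree = n) := by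
  induction n with
  | zero => simp [dualHahn_zero, dualHahnKernel_zero]
  | succ n ih =>
    obtain ⟨⟨hP, dP⟩, hR, dR⟩ := ih
    have hP' : (dualHahn K e (n + 1)).Monic ∧ (dualHahn K e (n + 1)).natDegree = n + 1 := by
      have d1 : (X * dualHahnKernel K e n).natDegree = n + 1 := by
        rw [natDegree_X_mul hR.ne_zero, dR]
      have d2 : (C (hahnWeight K e n) * dualHahn K e n).natDegree <
          (X * dualHahnKernel K e n).natDegree := by
        have := natDegree_C_mul_le (hahnWeight K e n) (dualHahn K e n)
        omega
      rw [eq_sub_iff_add_eq.2 (X_mul_dualHahnKernel K e n).symm]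
      exact ⟨(monic_X.mul hR).sub_of_left (degree_lt_degree d2),
        by rw [natDegree_sub_eq_left_of_natDegree_lt d2, d1]⟩
    refine ⟨hP', ?_⟩
    have d2 : (C (((n : ℚ) + 1) ^ 2) * dualHahnKernel K e n).natDegree <
        (dualHahn K e (n + 1)).natDegree := by
      have := natDegree_C_mul_le (((n : ℚ) + 1) ^ 2) (dualHahnKernel K e n)
      omega
    rw [sub_eq_iff_eq_add.1 (dualHahn_succ_eq K e n).symm]
    exact ⟨hP'.1.add_of_left (degree_lt_degree d2),
      by rw [natDegree_add_eq_left_of_natDegree_lt d2, hP'.2]⟩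

/-- The squared norms of the monic dual Hahn polynomials. -/
def hahnNorm (K e c : ℚ) (n : ℕ) : ℚ :=
  c * ∏ i ∈ range n, (-((i : ℚ) + 1) ^ 2 * hahnWeight K e i)

/-- The moment of the k-th term completes the partial product of weights to one independent of k,
leaving an alternating sum of binomials. -/
theorem map_dualHahn (K e c : ℚ) (M : ℚ[X] →ₗ[ℚ] ℚ)
    (hM : ∀ k, M (fallingBasis e k) = c * ∏ i ∈ range k, hahnWeight K e i) (n : ℕ) :
    M (dualHahn K e (n + 1)) = 0 := by
  have h : ∀ k ∈ range (n + 1 + 1),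
      M (C ((-1) ^ (n + 1 + k) * ((n + 1).choose k : ℚ) *
          ∏ i ∈ Ico k (n + 1), hahnWeight K e i) * fallingBasis e k) =
        (c * (-1) ^ (n + 1) * ∏ i ∈ range (n + 1), hahnWeight K e i) *
          ((-1) ^ k * ((n + 1).choose k : ℚ)) := by
    intro k hk
    rw [← smul_eq_C_mul, map_smul, hM, smul_eq_mul,
      ← prod_range_mul_prod_Ico _ (Nat.lt_succ_iff.1 (mem_range.1 hk))]
    ring
  rw [dualHahn, map_sum, sum_congr rfl h, ← mul_sum]
  have h0 := Int.alternating_sum_range_choose_of_ne (n := n + 1) (by omega)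
  have h1 : (∑ k ∈ range (n + 1 + 1), (-1 : ℚ) ^ k * ((n + 1).choose k : ℚ)) = 0 := by
    exact_mod_cast h0
  rw [h1, mul_zero]

/-- Induction on the power of X: the two relations between the families trade X^(k+1) P for X^(k+1)
R and then for X^k P. No weight need be nonzero, so the result also covers the range where the
determinants vanish. -/
theorem map_pow_mul_dualHahn (K e c : ℚ) (M : ℚ[X] →ₗ[ℚ] ℚ)
    (hM : ∀ k, M (fallingBasis e k) = c * ∏ i ∈ range k, hahnWeight K e i) (k : ℕ) :
    (∀ n, k < n → M (X ^ k * dualHahn K e n) = 0) ∧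
      M (X ^ k * dualHahn K e k) = hahnNorm K e c k ∧
      (∀ n, k < n → M (X ^ (k + 1) * dualHahnKernel K e n) = 0) ∧
      M (X ^ (k + 1) * dualHahnKernel K e k) = hahnWeight K e k * hahnNorm K e c k := by
  have hB : ∀ k n, M (X ^ (k + 1) * dualHahnKernel K e n) =
      M (X ^ k * dualHahn K e (n + 1)) + hahnWeight K e n * M (X ^ k * dualHahn K e n) := by
    intro k n
    rw [pow_succ, mul_assoc, X_mul_dualHahnKernel, mul_add, map_add, mul_left_comm,
      ← smul_eq_C_mul, map_smul, smul_eq_mul]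
  have hA : ∀ k n, M (X ^ k * dualHahn K e (n + 1)) =
      M (X ^ k * dualHahnKernel K e (n + 1)) -
        ((n : ℚ) + 1) ^ 2 * M (X ^ k * dualHahnKernel K e n) := by
    intro k n
    rw [dualHahn_succ_eq, mul_sub, map_sub, mul_left_comm, ← smul_eq_C_mul, map_smul,
      smul_eq_mul]
  suffices h : (∀ n, k < n → M (X ^ k * dualHahn K e n) = 0) ∧
      M (X ^ k * dualHahn K e k) = hahnNorm K e c k by
    refine ⟨h.1, h.2, fun n hn => ?_, ?_⟩
    · rw [hB, h.1 _ hn, h.1 _ (hn.trans n.lt_succ_self)]; ring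
    · rw [hB, h.2, h.1 _ k.lt_succ_self]; ring
  induction k with
  | zero =>
    refine ⟨fun n hn => ?_, ?_⟩
    · obtain ⟨n, rfl⟩ := Nat.exists_eq_succ_of_ne_zero hn.ne'
      rw [pow_zero, one_mul]
      exact map_dualHahn K e c M hM n
    · have := hM 0
      simp only [fallingBasis, range_zero, prod_empty, mul_one] at this
      simp [dualHahn_zero, hahnNorm, this]
  | succ k ih =>
    refine ⟨fun n hn => ?_, ?_⟩
    · obtain ⟨n, rfl⟩ := Nat.exists_eq_succ_of_ne_zero (by omega : n ≠ 0)
      rw [hA, hB, hB, ih.1 n (by omega), ih.1 (n + 1) (by omega), ih.1 (n + 1 + 1) (by omega)]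
      ring
    · rw [hA, hB, hB, ih.1 (k + 1) (by omega), ih.1 (k + 1 + 1) (by omega), ih.2, hahnNorm,
        hahnNorm, prod_range_succ]
      ring

/-! ### The alternating functional and its parity -/

/-- The functional `f ↦ f(1) - f(2) + ⋯ + (-1)^(s-1) f(s)`. -/
noncomputable def altEval (s : ℕ) : ℚ[X] →ₗ[ℚ] ℚ :=
  ∑ j ∈ Icc 1 s, ((-1 : ℚ) ^ (j - 1)) • leval (j : ℚ)

theorem altEval_apply (s : ℕ) (f : ℚ[X]) :
    altEval s f = ∑ j ∈ Icc 1 s, (-1 : ℚ) ^ (j - 1) * f.eval (j : ℚ) := by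
  simp [altEval, LinearMap.sum_apply]

theorem altEval_X_pow (s k : ℕ) : altEval s (X ^ k) = altPowerSum s k := by
  simp [altEval_apply, altPowerSum]

theorem sum_alternating_telescope (g : ℕ → ℚ) (s : ℕ) :
    ∑ j ∈ Icc 1 s, (-1 : ℚ) ^ (j - 1) * (g j + g (j - 1)) = g 0 - (-1) ^ s * g s := by
  induction s with
  | zero => simp
  | succ s ih =>
    rw [sum_Icc_succ_top (by omega), ih, Nat.add_sub_cancel]
    ring

/-- Reversing the sum multiplies the signs by (-1)^(s-1) and the values by (-1)^s, so the sum equals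
its negative. -/
theorem altEval_eq_zero_of_reflect (s : ℕ) (f : ℚ[X])
    (hf : ∀ x : ℚ, f.eval (s + 1 - x) = (-1) ^ s * f.eval x) : altEval s f = 0 := by
  have h : altEval s f = -altEval s f := by
    conv_lhs => rw [altEval_apply]
    rw [altEval_apply, ← sum_neg_distrib]
    refine sum_nbij' (fun j => s + 1 - j) (fun j => s + 1 - j) ?_ ?_ ?_ ?_ ?_
    · intro j hj; rw [mem_Icc] at *; omega
    · intro j hj; rw [mem_Icc] at *; omega
    · intro j hj; rw [mem_Icc] at *; omega
    · intro j hj; rw [mem_Icc] at *; omega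
    · intro j hj
      obtain ⟨h1, h2⟩ := mem_Icc.1 hj
      rw [Nat.cast_sub (by omega), Nat.cast_add, Nat.cast_one, hf]
      obtain ⟨a, rfl⟩ : ∃ a, j = a + 1 := ⟨j - 1, by omega⟩
      obtain ⟨b, rfl⟩ : ∃ b, s = a + 1 + b := ⟨s - (a + 1), by omega⟩
      rw [show a + 1 + b + 1 - (a + 1) - 1 = b by omega, Nat.add_sub_cancel]
      have hb : (-1 : ℚ) ^ b * (-1) ^ b = 1 := by rw [← mul_pow]; norm_num
      rw [pow_add, pow_add]
      linear_combination (-(-1 : ℚ) ^ a * (f.eval ((a + 1 : ℕ) : ℚ))) * hb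
  linarith

/-! ### Bases adapted to parity -/

/-- The family interleaving `f_k(w)` and `z g_k(w)`. -/
noncomputable def interleave (z w : ℚ[X]) (f g : ℕ → ℚ[X]) (i : ℕ) : ℚ[X] :=
  if i % 2 = 0 then (f (i / 2)).comp w else z * (g (i / 2)).comp w

theorem interleave_even (z w : ℚ[X]) (f g : ℕ → ℚ[X]) (k : ℕ) :
    interleave z w f g (2 * k) = (f k).comp w := by
  simp [interleave]

theorem interleave_odd (z w : ℚ[X]) (f g : ℕ → ℚ[X]) (k : ℕ) :
    interleave z w f g (2 * k + 1) = z * (g k).comp w := by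
  rw [interleave, if_neg (by omega), show (2 * k + 1) / 2 = k by omega]

theorem interleave_monic_natDegree {z w : ℚ[X]} {f g : ℕ → ℚ[X]} (hz : z.Monic)
    (hzd : z.natDegree = 1) (hw : w.Monic) (hwd : w.natDegree = 2)
    (hf : ∀ k, (f k).Monic ∧ (f k).natDegree = k) (hg : ∀ k, (g k).Monic ∧ (g k).natDegree = k)
    (i : ℕ) : (interleave z w f g i).Monic ∧ (interleave z w f g i).natDegree = i := by
  have hw0 : w.natDegree ≠ 0 := by omega
  obtain ⟨k, rfl | rfl⟩ := Nat.even_or_odd' i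
  · rw [interleave_even]
    exact ⟨(hf k).1.comp hw hw0, by rw [natDegree_comp, (hf k).2, hwd, mul_comm]⟩
  · rw [interleave_odd]
    have h := (hg k).1.comp hw hw0
    exact ⟨hz.mul h, by rw [hz.natDegree_mul h, natDegree_comp, (hg k).2, hwd, hzd]; ring⟩

theorem X_pow_monic_natDegree (k : ℕ) : ((X : ℚ[X]) ^ k).Monic ∧ ((X : ℚ[X]) ^ k).natDegree = k :=
  ⟨monic_X_pow k, natDegree_X_pow k⟩

/-- Used with b = 1/4 for s even, where w = (j - t - 1)(j - t) at the point j, and with b = 0 for s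
odd. -/
theorem centred_square_monic_natDegree (a b : ℚ) :
    ((X - C a) ^ 2 - C b : ℚ[X]).Monic ∧ ((X - C a) ^ 2 - C b : ℚ[X]).natDegree = 2 := by
  have hd : ((X - C a) ^ 2 : ℚ[X]).natDegree = 2 := by
    rw [(monic_X_sub_C a).natDegree_pow, natDegree_X_sub_C]
  have hlt : (C b : ℚ[X]).natDegree < ((X - C a) ^ 2 : ℚ[X]).natDegree := by
    rw [hd, natDegree_C]; norm_num
  exact ⟨((monic_X_sub_C a).pow 2).sub_of_left (degree_lt_degree hlt),
    by rw [natDegree_sub_eq_left_of_natDegree_lt hlt, hd]⟩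

/-! ### Moments in the falling basis, by telescoping -/

theorem eval_fallingBasis (e x : ℚ) (k : ℕ) :
    (fallingBasis e k).eval x = ∏ i ∈ range k, (x - (i : ℚ) * (i + e)) := by
  simp [fallingBasis, eval_prod]

/-- Since x(x + 1) - i(i + 1) = (x - i)(x + i + 1), for k ≥ 1 all three products share the factor x
∏ (x² - i²). This provides the antiderivative for s odd. -/
theorem prod_hahn_antidiff_zero (x : ℚ) (k : ℕ) :
    ∏ i ∈ range k, (x * (x + 1) - ((i : ℚ) + 1) * (i + 0)) +
      ∏ i ∈ range k, ((x - 1) * x - ((i : ℚ) + 1) * (i + 0)) =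
      2 * ∏ i ∈ range k, (x ^ 2 - (i : ℚ) * (i + 0)) := by
  rcases k with _ | k
  · norm_num
  have h1 : ∏ i ∈ range (k + 1), (x * (x + 1) - ((i : ℚ) + 1) * (i + 0)) =
      x * (x + k + 1) * ∏ i ∈ range k, (x ^ 2 - ((i : ℚ) + 1) ^ 2) := by
    induction k with
    | zero => simp
    | succ k ih => rw [prod_range_succ, ih, prod_range_succ _ k]; push_cast; ring
  have h2 : ∏ i ∈ range (k + 1), ((x - 1) * x - ((i : ℚ) + 1) * (i + 0)) =
      x * (x - k - 1) * ∏ i ∈ range k, (x ^ 2 - ((i : ℚ) + 1) ^ 2) := by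
    clear h1
    induction k with
    | zero => simp; ring
    | succ k ih => rw [prod_range_succ, ih, prod_range_succ _ k]; push_cast; ring
  have h3 : ∏ i ∈ range (k + 1), (x ^ 2 - (i : ℚ) * (i + 0)) =
      x ^ 2 * ∏ i ∈ range k, (x ^ 2 - ((i : ℚ) + 1) ^ 2) := by
    rw [prod_range_succ', mul_comm]
    push_cast
    congr 1
    · ring
    · exact prod_congr rfl fun i _ => by ring
  rw [h1, h2, h3]
  ring

/-- The factors (x - i)(x + i + 2) regroup into (x - i)(x + i + 1) up to one end factor. This
provides the antiderivative for s even. -/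
theorem prod_hahn_antidiff_one (x : ℚ) (k : ℕ) :
    (x + 1) * ∏ i ∈ range k, ((x + 1) ^ 2 - ((i : ℚ) + 1) * (i + 1)) +
      x * ∏ i ∈ range k, (x ^ 2 - ((i : ℚ) + 1) * (i + 1)) =
      (2 * x + 1) * ∏ i ∈ range k, (x * (x + 1) - (i : ℚ) * (i + 1)) := by
  have h1 : (x + 1) * ∏ i ∈ range k, ((x + 1) ^ 2 - ((i : ℚ) + 1) * (i + 1)) =
      (x + 1 + k) * ∏ i ∈ range k, (x * (x + 1) - (i : ℚ) * (i + 1)) := by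
    induction k with
    | zero => simp
    | succ k ih => rw [prod_range_succ, ← mul_assoc, ih, prod_range_succ]; push_cast; ring
  have h2 : x * ∏ i ∈ range k, (x ^ 2 - ((i : ℚ) + 1) * (i + 1)) =
      (x - k) * ∏ i ∈ range k, (x * (x + 1) - (i : ℚ) * (i + 1)) := by
    clear h1
    induction k with
    | zero => simp
    | succ k ih => rw [prod_range_succ, ← mul_assoc, ih, prod_range_succ]; push_cast; ring
  rw [h1, h2]
  ring

/-- The even part of the alternating functional on `2 r + 1` points, centred. -/
noncomputable def oddFunctional (r : ℕ) : ℚ[X] →ₗ[ℚ] ℚ :=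
  altEval (2 * r + 1) ∘ₗ (aeval ((X - C ((r : ℚ) + 1)) ^ 2 - C 0 : ℚ[X])).toLinearMap

theorem oddFunctional_apply (r : ℕ) (f : ℚ[X]) :
    oddFunctional r f = altEval (2 * r + 1) (f.comp ((X - C ((r : ℚ) + 1)) ^ 2 - C 0)) := by
  simp [oddFunctional, comp_eq_aeval]

theorem oddFunctional_fallingBasis (r k : ℕ) :
    oddFunctional r (fallingBasis 0 k) =
      1 * ∏ i ∈ range k, hahnWeight ((r : ℚ) * (r + 1)) 0 i := by
  -- At j = 0 and j = 2r + 1 the quadratic x(x + 1), x = j - r - 1, equals r(r + 1), whence K; the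
  -- two equal boundary terms add up.
  let g : ℕ → ℚ := fun j => 1 / 2 * ∏ i ∈ range k,
    (((j : ℚ) - (r + 1)) * ((j : ℚ) - (r + 1) + 1) - ((i : ℚ) + 1) * (i + 0))
  have h := sum_alternating_telescope g (2 * r + 1)
  rw [oddFunctional_apply, altEval_apply, one_mul]
  have hg0 : g 0 = 1 / 2 * ∏ i ∈ range k, hahnWeight ((r : ℚ) * (r + 1)) 0 i := by
    simp only [g, hahnWeight]
    congr 1
    exact prod_congr rfl fun i _ => by push_cast; ring
  have hgs : g (2 * r + 1) = 1 / 2 * ∏ i ∈ range k, hahnWeight ((r : ℚ) * (r + 1)) 0 i := by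
    simp only [g, hahnWeight]
    congr 1
    exact prod_congr rfl fun i _ => by push_cast; ring
  rw [hg0, hgs, (odd_two_mul_add_one r).neg_one_pow] at h
  convert h using 1
  · refine sum_congr rfl fun j hj => ?_
    obtain ⟨a, rfl⟩ : ∃ a, j = a + 1 := ⟨j - 1, by have := (mem_Icc.1 hj).1; omega⟩
    congr 1
    have := prod_hahn_antidiff_zero (((a + 1 : ℕ) : ℚ) - (r + 1)) k
    rw [eval_comp, eval_fallingBasis]
    simp only [g, Nat.add_sub_cancel]
    simp only [eval_sub, eval_pow, eval_X, eval_C, sub_zero]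
    rw [← mul_add]
    have e : ∀ i : ℕ, ((a : ℚ) - (r + 1)) * ((a : ℚ) - (r + 1) + 1) - ((i : ℚ) + 1) * (i + 0) =
        (((a + 1 : ℕ) : ℚ) - (r + 1) - 1) * (((a + 1 : ℕ) : ℚ) - (r + 1)) -
          ((i : ℚ) + 1) * (i + 0) := by
      intro i; push_cast; ring
    simp only [e]
    rw [this]
    ring
  · ring

/-- The odd part of the alternating functional on `2 t` points, centred. -/
noncomputable def evenFunctional (t : ℕ) : ℚ[X] →ₗ[ℚ] ℚ :=
  altEval (2 * t) ∘ₗ LinearMap.mulLeft ℚ (X - C ((t : ℚ) + 1 / 2)) ∘ₗ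
    (aeval ((X - C ((t : ℚ) + 1 / 2)) ^ 2 - C (1 / 4) : ℚ[X])).toLinearMap

theorem evenFunctional_apply (t : ℕ) (f : ℚ[X]) :
    evenFunctional t f = altEval (2 * t) ((X - C ((t : ℚ) + 1 / 2)) *
      f.comp ((X - C ((t : ℚ) + 1 / 2)) ^ 2 - C (1 / 4))) := by
  simp [evenFunctional, comp_eq_aeval]

theorem evenFunctional_fallingBasis (t k : ℕ) :
    evenFunctional t (fallingBasis 1 k) =
      -(t : ℚ) * ∏ i ∈ range k, hahnWeight ((t : ℚ) ^ 2) 1 i := by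
  -- The endpoints give j - t = ∓t, whence K = t² and, `g` being odd in j - t, the constant -t.
  let g : ℕ → ℚ := fun j => 1 / 2 * (((j : ℚ) - t) * ∏ i ∈ range k,
    (((j : ℚ) - t) ^ 2 - ((i : ℚ) + 1) * (i + 1)))
  have h := sum_alternating_telescope g (2 * t)
  rw [evenFunctional_apply, altEval_apply]
  have hg0 : g 0 = -(1 / 2 * t * ∏ i ∈ range k, hahnWeight ((t : ℚ) ^ 2) 1 i) := by
    simp [g, hahnWeight]
    ring
  have hgs : g (2 * t) = 1 / 2 * t * ∏ i ∈ range k, hahnWeight ((t : ℚ) ^ 2) 1 i := by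
    have : ((2 * t : ℕ) : ℚ) - t = t := by push_cast; ring
    simp only [g, hahnWeight, this]
    ring
  rw [hg0, hgs, (even_two_mul t).neg_one_pow] at h
  convert h using 1
  · refine sum_congr rfl fun j hj => ?_
    obtain ⟨a, rfl⟩ : ∃ a, j = a + 1 := ⟨j - 1, by have := (mem_Icc.1 hj).1; omega⟩
    congr 1
    have := prod_hahn_antidiff_one ((a : ℚ) - t) k
    rw [eval_mul, eval_comp, eval_fallingBasis]
    simp only [g, Nat.add_sub_cancel]
    simp only [eval_sub, eval_pow, eval_X, eval_C]
    rw [← mul_add]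
    have e : ((a + 1 : ℕ) : ℚ) - t = (a : ℚ) - t + 1 := by push_cast; ring
    have e2 : (((a + 1 : ℕ) : ℚ) - (t + 1 / 2)) ^ 2 - 1 / 4 =
      ((a : ℚ) - t) * ((a : ℚ) - t + 1) := by push_cast; ring
    rw [e, this, e2]
    push_cast
    ring
  · ring

/-! ### Evaluation of the Gram determinants -/

/-- The centred variable on `2 t` points. -/
noncomputable abbrev evenVar (t : ℕ) : ℚ[X] := X - C ((t : ℚ) + 1 / 2)

/-- The symmetric quadratic on `2 t` points. -/
noncomputable abbrev evenQuad (t : ℕ) : ℚ[X] := evenVar t ^ 2 - C (1 / 4)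

/-- The centred variable on `2 r + 1` points. -/
noncomputable abbrev oddVar (r : ℕ) : ℚ[X] := X - C ((r : ℚ) + 1)

/-- The symmetric quadratic on `2 r + 1` points. -/
noncomputable abbrev oddQuad (r : ℕ) : ℚ[X] := oddVar r ^ 2 - C 0

theorem altEval_comp_evenQuad (t : ℕ) (f : ℚ[X]) : altEval (2 * t) (f.comp (evenQuad t)) = 0 := by
  refine altEval_eq_zero_of_reflect _ _ fun x => ?_
  rw [(even_two_mul t).neg_one_pow, one_mul, eval_comp, eval_comp]
  congr 1
  simp only [eval_sub, eval_pow, eval_X, eval_C]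
  push_cast
  ring

theorem altEval_oddVar_mul_comp (r : ℕ) (f : ℚ[X]) :
    altEval (2 * r + 1) (oddVar r * f.comp (oddQuad r)) = 0 := by
  refine altEval_eq_zero_of_reflect _ _ fun x => ?_
  rw [(odd_two_mul_add_one r).neg_one_pow, eval_mul, eval_mul, eval_comp, eval_comp]
  have h : (oddQuad r).eval (((2 * r + 1 : ℕ) : ℚ) + 1 - x) = (oddQuad r).eval x := by
    simp only [eval_sub, eval_pow, eval_X, eval_C]
    push_cast
    ring
  rw [h]
  simp only [eval_sub, eval_X, eval_C]
  push_cast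
  ring

theorem hankelDet_altPowerSum_even (t n : ℕ) :
    hankelDet n (fun k => altPowerSum (2 * t) k) =
      Matrix.det (Matrix.of fun i j : Fin (n + 1) => altEval (2 * t)
        (interleave (evenVar t) (evenQuad t) (X ^ ·) (X ^ ·) i *
          interleave (evenVar t) (evenQuad t) (dualHahn ((t : ℚ) ^ 2) 1)
            (dualHahn ((t : ℚ) ^ 2) 1) j)) := by
  have hw := centred_square_monic_natDegree ((t : ℚ) + 1 / 2) (1 / 4)
  have hp := interleave_monic_natDegree (z := evenVar t) (monic_X_sub_C _) (natDegree_X_sub_C _)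
    hw.1 hw.2 X_pow_monic_natDegree X_pow_monic_natDegree
  have hP := fun n => (dualHahn_monic_and_kernel ((t : ℚ) ^ 2) 1 n).1
  have hq := interleave_monic_natDegree (z := evenVar t) (monic_X_sub_C _) (natDegree_X_sub_C _)
    hw.1 hw.2 hP hP
  simp only [← altEval_X_pow]
  exact hankelDet_eq_det_gram _ _ _ (fun i => (hp i).1) (fun i => (hp i).2)
    (fun i => (hq i).1) (fun i => (hq i).2) n

theorem hankelDet_two_mul_altPowerSum_even (t m : ℕ) :
    hankelDet (2 * m) (fun k => altPowerSum (2 * t) k) = 0 := by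
  rw [hankelDet_altPowerSum_even]
  refine Matrix.det_eq_zero_of_column_eq_zero (Fin.last (2 * m)) fun i => ?_
  rw [Matrix.of_apply, Fin.val_last, interleave_even]
  obtain ⟨k, hk | hk⟩ := Nat.even_or_odd' (i : ℕ)
  · rw [hk, interleave_even, ← mul_comp, altEval_comp_evenQuad]
  · rw [hk, interleave_odd, mul_assoc, ← mul_comp]
    -- The row index 2k + 1 ≤ 2m forces k < m, so orthogonality applies.
    have := (map_pow_mul_dualHahn _ 1 _ _ (evenFunctional_fallingBasis t) k).1 m (by omega)
    rwa [evenFunctional_apply] at this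

theorem hankelDet_two_mul_add_one_altPowerSum_even (t m : ℕ) :
    hankelDet (2 * m + 1) (fun k => altPowerSum (2 * t) k) =
      (-1) ^ (m + 1) * (∏ k ∈ range (m + 1), hahnNorm ((t : ℚ) ^ 2) 1 (-t) k) ^ 2 := by
  rw [hankelDet_altPowerSum_even]
  -- Splits the index as 2a + x, with x its parity.
  let e : Fin (m + 1) × Fin 2 ≃ Fin (2 * m + 1 + 1) :=
    finProdFinEquiv.trans (finCongr (by omega))
  let A : Matrix (Fin (m + 1)) (Fin (m + 1)) ℚ :=
    Matrix.of fun i j => evenFunctional t (X ^ (i : ℕ) * dualHahn ((t : ℚ) ^ 2) 1 j)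
  have hA : A.det = ∏ k ∈ range (m + 1), hahnNorm ((t : ℚ) ^ 2) 1 (-t) k := by
    rw [Matrix.det_of_isLowerTriangular]
    · rw [← Fin.prod_univ_eq_prod_range]
      exact prod_congr rfl fun i _ =>
        (map_pow_mul_dualHahn _ 1 _ _ (evenFunctional_fallingBasis t) i).2.1
    · intro i j hij
      have hij : (i : ℕ) < j := hij
      exact (map_pow_mul_dualHahn _ 1 _ _ (evenFunctional_fallingBasis t) i).1 j hij
  rw [← Matrix.det_submatrix_equiv_self e]
  have key : (Matrix.of fun i j : Fin (2 * m + 1 + 1) => altEval (2 * t)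
        (interleave (evenVar t) (evenQuad t) (X ^ ·) (X ^ ·) i *
          interleave (evenVar t) (evenQuad t) (dualHahn ((t : ℚ) ^ 2) 1)
            (dualHahn ((t : ℚ) ^ 2) 1) j)).submatrix e e =
      Matrix.kroneckerMap (· * ·) A !![0, 1; 1, 0] := by
    ext ⟨a, x⟩ ⟨b, y⟩
    have he : ∀ (a : Fin (m + 1)) (x : Fin 2), ((e (a, x) : Fin _) : ℕ) = x + 2 * a :=
      fun a x => rfl
    simp only [Matrix.submatrix_apply, Matrix.of_apply, Matrix.kroneckerMap_apply, he, A,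
      evenFunctional_apply]
    fin_cases x <;> fin_cases y <;>
      simp only [Fin.zero_eta, Fin.mk_one, zero_add, add_comm 1 (2 * _), interleave_even,
        interleave_odd, Matrix.cons_val', Matrix.cons_val_zero, Matrix.cons_val_one,
        Matrix.cons_val_fin_one, mul_zero, mul_one]
    · rw [← mul_comp, altEval_comp_evenQuad]
    · rw [mul_left_comm, ← mul_comp]
    · rw [mul_assoc, ← mul_comp]
    · rw [mul_mul_mul_comm, ← mul_comp]
      -- z² = w + 1/4, so a product of two odd members is a polynomial in w and is killed.
      have h : evenVar t * evenVar t = (X + C (1 / 4) : ℚ[X]).comp (evenQuad t) := by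
        rw [add_comp, X_comp, C_comp, sub_add_cancel, pow_two]
      rw [h, ← mul_comp, altEval_comp_evenQuad]
  rw [key, Matrix.det_kronecker, hA, Matrix.det_fin_two_of]
  simp only [Fintype.card_fin]
  norm_num
  ring

theorem hankelDet_altPowerSum_odd (r n : ℕ) :
    hankelDet n (fun k => altPowerSum (2 * r + 1) k) = ∏ i ∈ range (n + 1),
      (if i % 2 = 0 then 1 else hahnWeight ((r : ℚ) * (r + 1)) 0 (i / 2)) *
        hahnNorm ((r : ℚ) * (r + 1)) 0 1 (i / 2) := by
  have hw := centred_square_monic_natDegree ((r : ℚ) + 1) 0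
  have hp := interleave_monic_natDegree (z := oddVar r) (monic_X_sub_C _) (natDegree_X_sub_C _)
    hw.1 hw.2 X_pow_monic_natDegree X_pow_monic_natDegree
  have hP := dualHahn_monic_and_kernel ((r : ℚ) * (r + 1)) 0
  have hq := interleave_monic_natDegree (z := oddVar r) (monic_X_sub_C _) (natDegree_X_sub_C _)
    hw.1 hw.2 (fun n => (hP n).1) (fun n => (hP n).2)
  have ortho := map_pow_mul_dualHahn _ 0 _ _ (oddFunctional_fallingBasis r)
  -- Here z² = w: the odd block is the Gram matrix of f ↦ M(X f), hence the kernel polynomials.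
  have hz : ∀ a b : ℕ, oddVar r * (X ^ a : ℚ[X]).comp (oddQuad r) *
      (oddVar r * (dualHahnKernel ((r : ℚ) * (r + 1)) 0 b).comp (oddQuad r)) =
      (X ^ (a + 1) * dualHahnKernel ((r : ℚ) * (r + 1)) 0 b).comp (oddQuad r) := by
    intro a b
    simp only [mul_comp, X_pow_comp, oddQuad, C_0, sub_zero]
    ring
  simp only [← altEval_X_pow]
  rw [hankelDet_eq_det_gram _ _ _ (fun i => (hp i).1) (fun i => (hp i).2) (fun i => (hq i).1)
    (fun i => (hq i).2) n, Matrix.det_of_isLowerTriangular, ← Fin.prod_univ_eq_prod_range]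
  · refine prod_congr rfl fun i _ => ?_
    rw [Matrix.of_apply]
    obtain ⟨a, ha | ha⟩ := Nat.even_or_odd' (i : ℕ)
    · rw [ha, interleave_even, interleave_even, ← mul_comp, ← oddFunctional_apply, (ortho a).2.1]
      simp
    · rw [ha, interleave_odd, interleave_odd, hz, ← oddFunctional_apply, (ortho a).2.2.2,
        if_neg (by omega), show (2 * a + 1) / 2 = a by omega]
  · intro i j hij
    have hij : (i : ℕ) < j := hij
    rw [Matrix.of_apply]
    obtain ⟨a, ha | ha⟩ := Nat.even_or_odd' (i : ℕ) <;>
      obtain ⟨b, hb | hb⟩ := Nat.even_or_odd' (j : ℕ) <;> rw [ha, hb] at hij ⊢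
    · rw [interleave_even, interleave_even, ← mul_comp, ← oddFunctional_apply]
      exact (ortho a).1 b (by omega)
    · rw [interleave_even, interleave_odd, mul_left_comm, ← mul_comp, altEval_oddVar_mul_comp]
    · rw [interleave_even, interleave_odd, mul_assoc, ← mul_comp, altEval_oddVar_mul_comp]
    · rw [interleave_odd, interleave_odd, hz, ← oddFunctional_apply]
      exact (ortho a).2.2.1 b (by omega)

/-! ### Closed product formulas -/

theorem prod_Icc_pow_succ (f : ℕ → ℚ) (m : ℕ) :
    ∏ l ∈ Icc 1 (m + 1), f l ^ (2 * (m + 1 + 1 - l)) =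
      (∏ l ∈ Icc 1 m, f l ^ (2 * (m + 1 - l))) * (∏ l ∈ range (m + 1), f (l + 1)) ^ 2 := by
  have h : ∏ l ∈ range (m + 1), f (l + 1) = ∏ l ∈ Icc 1 (m + 1), f l := by
    rw [range_eq_Ico, prod_Ico_add' f 0 (m + 1) 1]
    rfl
  -- The added factor l = m + 1 has exponent 0.
  have h' : ∏ l ∈ Icc 1 m, f l ^ (2 * (m + 1 - l)) =
      ∏ l ∈ Icc 1 (m + 1), f l ^ (2 * (m + 1 - l)) := by
    rw [prod_Icc_succ_top (by omega)]
    simp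
  rw [h, h', ← prod_pow, ← prod_mul_distrib]
  refine prod_congr rfl fun l hl => ?_
  rw [← pow_add]
  congr 1
  have := (mem_Icc.1 hl).2
  omega

theorem prod_hahnNorm_even (t m : ℕ) :
    (-1) ^ (m + 1) * (∏ k ∈ range (m + 1), hahnNorm ((t : ℚ) ^ 2) 1 (-t) k) ^ 2 =
      (-(t : ℚ) ^ 2) ^ (m + 1) * ∏ l ∈ Icc 1 m,
        ((l : ℚ) ^ 2 * ((t : ℚ) ^ 2 - (l : ℚ) ^ 2)) ^ (2 * (m + 1 - l)) := by
  induction m with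
  | zero => simp [hahnNorm]
  | succ m ih =>
    have h : hahnNorm ((t : ℚ) ^ 2) 1 (-t) (m + 1) ^ 2 = (t : ℚ) ^ 2 *
        (∏ l ∈ range (m + 1),
          (((l + 1 : ℕ) : ℚ) ^ 2 * ((t : ℚ) ^ 2 - ((l + 1 : ℕ) : ℚ) ^ 2))) ^ 2 := by
      rw [hahnNorm, mul_pow, neg_sq, ← prod_pow, ← prod_pow]
      congr 1
      refine prod_congr rfl fun i _ => ?_
      simp only [hahnWeight]
      push_cast
      ring
    rw [prod_range_succ, prod_Icc_pow_succ (fun l => (l : ℚ) ^ 2 * ((t : ℚ) ^ 2 - (l : ℚ) ^ 2)),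
      mul_pow, h, pow_succ (-1), pow_succ (-(t : ℚ) ^ 2)]
    linear_combination (-(t : ℚ) ^ 2 * (∏ l ∈ range (m + 1),
      (((l + 1 : ℕ) : ℚ) ^ 2 * ((t : ℚ) ^ 2 - ((l + 1 : ℕ) : ℚ) ^ 2))) ^ 2) * ih

theorem hahnNorm_odd (r m : ℕ) :
    hahnNorm ((r : ℚ) * (r + 1)) 0 1 m = (-1) ^ m * ∏ l ∈ range m,
      (((l + 1 : ℕ) : ℚ) ^ 2 / 4 *
        (((2 * r + 1 : ℕ) : ℚ) ^ 2 - (2 * ((l + 1 : ℕ) : ℚ) - 1) ^ 2)) := by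
  rw [hahnNorm, one_mul, show (-1 : ℚ) ^ m = ∏ _l ∈ range m, (-1 : ℚ) by simp,
    ← prod_mul_distrib]
  refine prod_congr rfl fun i _ => ?_
  simp only [hahnWeight]
  push_cast
  ring

theorem hahnWeight_odd (r m : ℕ) : hahnWeight ((r : ℚ) * (r + 1)) 0 m =
    (((2 * r + 1 : ℕ) : ℚ) ^ 2 - (2 * (m : ℚ) + 1) ^ 2) / 4 := by
  simp only [hahnWeight]
  push_cast
  ring

/-- Raising m by one multiplies by v h_m h_{m+1}, with v = `hahnWeight` at m. As h_{m+1} = -(m + 1)²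
v h_m, this amounts to -h_{m+1}²/(m + 1)², the source of (-1)^m / m!². -/
theorem hankelDet_two_mul_altPowerSum_odd (r m : ℕ) :
    hankelDet (2 * m) (fun k => altPowerSum (2 * r + 1) k) =
      (-1 : ℚ) ^ m / (m.factorial : ℚ) ^ 2 * ∏ l ∈ Icc 1 m,
        ((l : ℚ) ^ 2 / 4 * (((2 * r + 1 : ℕ) : ℚ) ^ 2 - (2 * (l : ℚ) - 1) ^ 2)) ^
          (2 * (m + 1 - l)) := by
  rw [hankelDet_altPowerSum_odd]
  induction m with
  | zero => simp [hahnNorm]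
  | succ m ih =>
    rw [show 2 * (m + 1) + 1 = 2 * m + 1 + 1 + 1 by ring, prod_range_succ, prod_range_succ, ih,
      prod_Icc_pow_succ
        (fun l => (l : ℚ) ^ 2 / 4 * (((2 * r + 1 : ℕ) : ℚ) ^ 2 - (2 * (l : ℚ) - 1) ^ 2)),
      if_neg (by omega), if_pos (by omega), show (2 * m + 1) / 2 = m by omega,
      show (2 * m + 1 + 1) / 2 = m + 1 by omega, hahnNorm_odd, hahnNorm_odd, hahnWeight_odd,
      prod_range_succ _ m, Nat.factorial_succ]
    have hs : (-1 : ℚ) ^ m * (-1) ^ m = 1 := by rw [← mul_pow]; norm_num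
    have hf : (m.factorial : ℚ) ≠ 0 := by exact_mod_cast m.factorial_ne_zero
    generalize ∏ l ∈ range m, (((l + 1 : ℕ) : ℚ) ^ 2 / 4 *
        (((2 * r + 1 : ℕ) : ℚ) ^ 2 - (2 * ((l + 1 : ℕ) : ℚ) - 1) ^ 2)) = Q
    generalize ∏ l ∈ Icc 1 m, (_ : ℚ) = E
    generalize ((2 * r + 1 : ℕ) : ℚ) = S
    rw [pow_succ (-1)]
    generalize (-1 : ℚ) ^ m = σ at *
    push_cast
    have hm : (m : ℚ) + 1 ≠ 0 := by positivity
    generalize hw : (S ^ 2 - (2 * (m : ℚ) + 1) ^ 2) / 4 = w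
    have hF : ((m : ℚ) + 1) ^ 2 / 4 * (S ^ 2 - (2 * ((m : ℚ) + 1) - 1) ^ 2) =
        (m + 1) ^ 2 * w := by
      rw [← hw]; ring
    rw [hF]
    trans σ * -1 / (m.factorial : ℚ) ^ 2 * E * w ^ 2 * Q ^ 2 * (m + 1) ^ 2
    · linear_combination
        (-σ / (m.factorial : ℚ) ^ 2 * E * w ^ 2 * Q ^ 2 * (m + 1) ^ 2) * hs
    · field_simp

/-- Raising m by one multiplies by the weight at m + 1 times h_{m+1}²; the factorials and powers of
16 come from that square. -/
theorem hankelDet_two_mul_add_one_altPowerSum_odd (r m : ℕ) :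
    hankelDet (2 * m + 1) (fun k => altPowerSum (2 * r + 1) k) =
      1 / (4 : ℚ) ^ (m + 1) * ∏ l ∈ Icc 0 m, ((l.factorial : ℚ) ^ 4 / (16 : ℚ) ^ l *
        (((2 * r + 1 : ℕ) : ℚ) ^ 2 - (2 * (l : ℚ) + 1) ^ 2) ^ (2 * (m - l) + 1)) := by
  rw [hankelDet_altPowerSum_odd]
  induction m with
  | zero =>
    simp [hahnNorm, prod_range_succ, hahnWeight]
    ring
  | succ m ih =>
    have hstep : ∏ l ∈ Icc 0 m, ((l.factorial : ℚ) ^ 4 / (16 : ℚ) ^ l *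
        (((2 * r + 1 : ℕ) : ℚ) ^ 2 - (2 * (l : ℚ) + 1) ^ 2) ^ (2 * (m + 1 - l) + 1)) =
        (∏ l ∈ Icc 0 m, ((l.factorial : ℚ) ^ 4 / (16 : ℚ) ^ l *
        (((2 * r + 1 : ℕ) : ℚ) ^ 2 - (2 * (l : ℚ) + 1) ^ 2) ^ (2 * (m - l) + 1))) *
        (∏ l ∈ range (m + 1), (((2 * r + 1 : ℕ) : ℚ) ^ 2 - (2 * (l : ℚ) + 1) ^ 2)) ^ 2 := by
      rw [Nat.range_succ_eq_Icc_zero, ← prod_pow, ← prod_mul_distrib]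
      refine prod_congr rfl fun l hl => ?_
      have := (mem_Icc.1 hl).2
      rw [mul_assoc, ← pow_add]
      congr 2
      omega
    have hQ : ∏ l ∈ range (m + 1), (((l + 1 : ℕ) : ℚ) ^ 2 / 4 *
        (((2 * r + 1 : ℕ) : ℚ) ^ 2 - (2 * ((l + 1 : ℕ) : ℚ) - 1) ^ 2)) =
        ((m + 1).factorial : ℚ) ^ 2 / 4 ^ (m + 1) *
        ∏ l ∈ range (m + 1), (((2 * r + 1 : ℕ) : ℚ) ^ 2 - (2 * (l : ℚ) + 1) ^ 2) := by
      rw [← prod_range_add_one_eq_factorial, Nat.cast_prod, ← prod_pow,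
        show (4 : ℚ) ^ (m + 1) = ∏ _l ∈ range (m + 1), (4 : ℚ) by simp, ← prod_div_distrib,
        ← prod_mul_distrib]
      refine prod_congr rfl fun i _ => ?_
      push_cast
      ring
    have hs : ((-1 : ℚ) ^ (m + 1)) ^ 2 = 1 := by rw [← pow_mul, mul_comm, pow_mul]; norm_num
    have h16 : (16 : ℚ) ^ (m + 1) = (4 ^ (m + 1)) ^ 2 := by
      rw [← pow_mul, mul_comm, pow_mul]; norm_num
    rw [show 2 * (m + 1) + 1 + 1 = 2 * m + 1 + 1 + 1 + 1 by ring, prod_range_succ,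
      prod_range_succ, ih, prod_Icc_succ_top (Nat.zero_le _), hstep,
      if_pos (by omega), if_neg (by omega), show (2 * m + 1 + 1) / 2 = m + 1 by omega,
      show (2 * m + 1 + 1 + 1) / 2 = m + 1 by omega, hahnNorm_odd, hahnWeight_odd, hQ,
      Nat.sub_self, pow_succ (4 : ℚ) (m + 1), h16]
    generalize (4 : ℚ) ^ (m + 1) = F
    generalize (-1 : ℚ) ^ (m + 1) = σ at *
    generalize ∏ l ∈ range (m + 1), (_ : ℚ) = U
    generalize ∏ l ∈ Icc 0 m, (_ : ℚ) = E
    generalize ((2 * r + 1 : ℕ) : ℚ) ^ 2 - (2 * ((m + 1 : ℕ) : ℚ) + 1) ^ 2 = u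
    generalize ((m + 1).factorial : ℚ) = f
    linear_combination (1 / F * E * (f ^ 2 / F * U) ^ 2 * (u / 4)) * hs

theorem corollary4p5 :
    (∀ t : ℕ, 1 ≤ t → ∀ m : ℕ,
      hankelDet (2 * m) (fun k => altPowerSum (2 * t) k) = 0 ∧
      hankelDet (2 * m + 1) (fun k => altPowerSum (2 * t) k) =
        (-(t : ℚ) ^ 2) ^ (m + 1) *
          ∏ l ∈ Finset.Icc 1 m,
            ((l : ℚ) ^ 2 * ((t : ℚ) ^ 2 - (l : ℚ) ^ 2)) ^ (2 * (m + 1 - l)) ∧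
      (t ≤ m → hankelDet (2 * m + 1) (fun k => altPowerSum (2 * t) k) = 0)) ∧
    (∀ s : ℕ, Odd s → ∀ m : ℕ,
      hankelDet (2 * m) (fun k => altPowerSum s k) =
        (-1 : ℚ) ^ m / (Nat.factorial m : ℚ) ^ 2 *
          ∏ l ∈ Finset.Icc 1 m,
            ((l : ℚ) ^ 2 / 4 * ((s : ℚ) ^ 2 - (2 * (l : ℚ) - 1) ^ 2)) ^ (2 * (m + 1 - l)) ∧
      hankelDet (2 * m + 1) (fun k => altPowerSum s k) =
        1 / (4 : ℚ) ^ (m + 1) *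
          ∏ l ∈ Finset.Icc 0 m,
            ((Nat.factorial l : ℚ) ^ 4 / (16 : ℚ) ^ l *
              ((s : ℚ) ^ 2 - (2 * (l : ℚ) + 1) ^ 2) ^ (2 * (m - l) + 1)) ∧
      (((s : ℚ) + 1) / 2 ≤ (m : ℚ) →
        hankelDet (2 * m) (fun k => altPowerSum s k) = 0) ∧
      (((s : ℚ) - 1) / 2 ≤ (m : ℚ) →
        hankelDet (2 * m + 1) (fun k => altPowerSum s k) = 0)) := by
  refine ⟨fun t ht m => ?_, fun s hs m => ?_⟩
  · have h := (hankelDet_two_mul_add_one_altPowerSum_even t m).trans (prod_hahnNorm_even t m)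
    refine ⟨hankelDet_two_mul_altPowerSum_even t m, h, fun htm => ?_⟩
    rw [h, prod_eq_zero (mem_Icc.2 ⟨ht, htm⟩), mul_zero]
    rw [sub_self, mul_zero, zero_pow (by omega)]
  · obtain ⟨r, rfl⟩ := hs
    have h1 := hankelDet_two_mul_altPowerSum_odd r m
    have h2 := hankelDet_two_mul_add_one_altPowerSum_odd r m
    refine ⟨h1, h2, fun hm => ?_, fun hm => ?_⟩
    · have hrm : r + 1 ≤ m := by
        have : ((r + 1 : ℕ) : ℚ) ≤ m := by push_cast at hm ⊢; linarith
        exact_mod_cast this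
      -- The factor l = r + 1 vanishes because 2l - 1 = s.
      rw [h1, prod_eq_zero (mem_Icc.2 ⟨Nat.succ_pos r, hrm⟩), mul_zero]
      rw [← zero_pow (by omega : 2 * (m + 1 - (r + 1)) ≠ 0)]
      congr 1
      push_cast
      ring
    · have hrm : r ≤ m := by
        have : (r : ℚ) ≤ m := by push_cast at hm; linarith
        exact_mod_cast this
      rw [h2, prod_eq_zero (mem_Icc.2 ⟨Nat.zero_le r, hrm⟩), mul_zero]
      push_cast
      rw [sub_self, zero_pow (by omega), mul_zero]
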